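/- Let $\mathcal H$ be a complex Hilbert space of finite dimension, and endow the space $\mathcal B(\mathcal H)$ of linear operators on $\mathcal H$ with its norm topology. Let $S_1^+\subset\mathcal B(\mathcal H)$ be the set of density matrices (self-adjoint positive semi-definite operators of trace $1$), and let $\mathbf P_{\mathcal H}=\{P_\psi:\phi\mapsto\langle\psi|\phi\rangle\,\psi \;:\; \psi\in\mathcal H,\ \|\psi\|=1\}$ be the set of pure states. Let $d$ be any distance on $\mathbf P_{\mathcal H}$ that induces on $\mathbf P_{\mathcal H}$ the topology inherited from $\mathcal B(\mathcal H)$, and let $p\ge 1$ be real. For Borel probability measures $\mu,\nu$ on $\mathbf P_{\mathcal H}$ let $$W_p(\mu,\nu)=\Big(\inf_{\pi}\iint d(P,Q)^p\,\mathrm d\pi(P,Q)\Big)^{1/p},$$ where $\pi$ runs over the probability measures on $\mathbf P_{\mathcal H}\times\mathbf P_{\mathcal H}$ with marginals $\mu$ and $\nu$. For $\rho,\sigma\in S_1^+$ let $\mathcal P_\rho$ be the set of Borel probability measures $\mu$ on $\mathbf P_{\mathcal H}$ with $\int P\,\mathrm d\mu(P)=\rho$, and define the folded Kantorovich semi-distance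 $$\widehat D_p(\rho,\sigma)=\inf_{\mu\in\mathcal P_\rho}\ \inf_{\nu\in\mathcal P_\sigma} W_p(\mu,\nu)$$ and the Beatty–Stilck França semi-distance $$D_p^{\text{B-F}}(\rho,\sigma)=\Big(\inf\ \sum_{j=1}^J q_j\,d(P_j,Q_j)^p\Big)^{1/p},$$ where the infimum is over all $J\ge 1$, $q_j>0$ and $P_j,Q_j\in\mathbf P_{\mathcal H}$ ($1\le j\le J$) with $\sum_j q_jP_j=\rho$ and $\sum_j q_jQ_j=\sigma$. Then $\widehat D_p=D_p^{\text{B-F}}$ on $S_1^+\times S_1^+$, this function is finite, and it separates points: if $\rho,\sigma\in S_1^+$ and $\widehat D_p(\rho,\sigma)=0$ (equivalently $D_p^{\text{B-F}}(\rho,\sigma)=0$), then $\rho=\sigma$. In particular, no Hölder-type lower bound of $d(P,Q)$ in terms of $\|P-Q\|$ is assumed. -/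

import Mathlib

open MeasureTheory
open scoped ENNReal

noncomputable section

namespace QuantumFolded

/-- Distances on a set `E`: real-valued, separating, symmetric, subadditive (nonnegativity
follows from these). -/
structure IsDistance {E : Type*} (d : E → E → ℝ) : Prop where
  eq_zero_iff : ∀ x y, d x y = 0 ↔ x = y
  symm : ∀ x y, d x y = d y x
  triangle : ∀ x y z, d x z ≤ d x y + d y z

/-- The topology generated by the open balls of `d` is the ambient topology of `E`. -/
def InducesTopology {E : Type*} [TopologicalSpace E] (d : E → E → ℝ) : Prop :=
  ∀ s : Set E, IsOpen s ↔ ∀ x ∈ s, ∃ ε > 0, ∀ y, d x y < ε → y ∈ s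

/-- `D` separates the points of the set `S`. -/
def SeparatesPointsOn {X : Type*} (S : Set X) (D : X → X → ℝ≥0∞) : Prop :=
  ∀ x ∈ S, ∀ y ∈ S, D x y = 0 → x = y

variable (H : Type*) [NormedAddCommGroup H] [InnerProductSpace ℂ H]

/-- Density matrices: positive semi-definite self-adjoint operators of trace one. -/
def densityMatrices : Set (H →L[ℂ] H) :=
  {ρ | ρ.IsPositive ∧ LinearMap.trace ℂ H (ρ : H →ₗ[ℂ] H) = 1}

/-- Pure states: the rank-one projectors `φ ↦ ⟨ψ|φ⟩ ψ` with `ψ` a unit vector. -/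
def pureStates : Set (H →L[ℂ] H) :=
  {P | ∃ ψ : H, ‖ψ‖ = 1 ∧ P = InnerProductSpace.rankOne ℂ ψ ψ}

/-- The type of pure states, with the topology and the Borel sigma-algebra inherited from the
operator norm. -/
abbrev PureState : Type _ := ↥(pureStates H)

variable {H}

/-- The probability measures on the pure states with barycenter `ρ`. -/
def representing (ρ : H →L[ℂ] H) : Set (ProbabilityMeasure (PureState H)) :=
  {μ | ∫ P : PureState H, (P : H →L[ℂ] H) ∂(μ : Measure (PureState H)) = ρ}

/-- Couplings of two probability measures. -/
def couplings {E : Type*} [MeasurableSpace E] (μ ν : ProbabilityMeasure E) :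
    Set (ProbabilityMeasure (E × E)) :=
  {π | (π : Measure (E × E)).map Prod.fst = μ ∧ (π : Measure (E × E)).map Prod.snd = ν}

/-- The Wasserstein-`p` distance associated with `d`. -/
def wasserstein {E : Type*} [MeasurableSpace E] (d : E → E → ℝ) (p : ℝ)
    (μ ν : ProbabilityMeasure E) : ℝ≥0∞ :=
  (⨅ π ∈ couplings μ ν,
    ∫⁻ z : E × E, ENNReal.ofReal (d z.1 z.2 ^ p) ∂(π : Measure (E × E))) ^ (1 / p)

/-- The folded Kantorovich-`p` semi-distance associated with `d`. -/
def foldedKantorovich (d : PureState H → PureState H → ℝ) (p : ℝ) (ρ σ : H →L[ℂ] H) : ℝ≥0∞ :=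
  ⨅ μ ∈ representing ρ, ⨅ ν ∈ representing σ, wasserstein d p μ ν

/-- Transport plans of Beatty and Stilck França from `ρ` to `σ`: finite families of positive
weights and pairs of pure states whose weighted sums are `ρ` and `σ`. -/
structure BFPlan (ρ σ : H →L[ℂ] H) where
  card : ℕ
  card_pos : 0 < card
  q : Fin card → ℝ
  q_pos : ∀ j, 0 < q j
  source : Fin card → PureState H
  target : Fin card → PureState H
  sum_source : ∑ j, q j • (source j : H →L[ℂ] H) = ρ
  sum_target : ∑ j, q j • (target j : H →L[ℂ] H) = σ

/-- The `p`-semi-distance of Beatty and Stilck França associated with `d`. -/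
def beattyFranca (d : PureState H → PureState H → ℝ) (p : ℝ) (ρ σ : H →L[ℂ] H) : ℝ≥0∞ :=
  (⨅ t : BFPlan ρ σ,
    ∑ j, ENNReal.ofReal (t.q j * d (t.source j) (t.target j) ^ p)) ^ (1 / p)

end QuantumFolded

end

open MeasureTheory Set
open scoped ENNReal

noncomputable section

/-! Send a pair of pure states to `((P, Q), d P Q ^ p)` in a finite-dimensional real space, and let
`C` be the convex hull of the image. Since pure states have trace one, finite plans from `ρ` to `σ`
of cost `c` are exactly convex combinations producing the point `((ρ, σ), c)` of `C`. Pure states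
form a compact set and `d` is continuous, so by Carathéodory `C` is compact.

Two consequences carry the proof. The mean of the map under any coupling lies in the closed convex
set `C`, so each coupling has the cost of a finite plan (`exists_plan_of_coupling`); conversely a
plan is a discrete coupling, and the two infima agree. The slice of `C` over `(ρ, σ)` is compact,
and nonempty because density matrices are mixtures of pure states, so a cheapest plan exists
(`exists_optimal_plan`). This gives finiteness, and when the infimum is zero a plan of cost exactly
zero, which matches equal states and forces `ρ = σ`; no quantitative bound on `d` enters. -/

/-- In a finite-dimensional real space the convex hull of a compact set is compact. -/
theorem IsCompact.convexHull_of_finiteDimensional {V : Type*} [NormedAddCommGroup V]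
    [NormedSpace ℝ V] [FiniteDimensional ℝ V] {s : Set V} (hs : IsCompact s) :
    IsCompact (convexHull ℝ s) := by
  rcases s.eq_empty_or_nonempty with rfl | ⟨x₀, hx₀⟩
  · simp
  -- By Carathéodory, `dim V + 1` points suffice, so the hull is the image of a compact set of
  -- weights and points.
  let κ := Fin (Module.finrank ℝ V + 1)
  let F : (κ → ℝ) × (κ → V) → V := fun a => ∑ i, a.1 i • a.2 i
  have hF : Continuous F := by fun_prop
  have hK : IsCompact (stdSimplex ℝ κ ×ˢ Set.pi univ fun _ : κ => s) :=
    (isCompact_stdSimplex ℝ κ).prod (isCompact_univ_pi fun _ => hs)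
  convert hK.image hF
  apply Subset.antisymm
  · intro x hx
    obtain ⟨ι, _, z, w, hz, hind, hw, hw1, hwx⟩ := eq_pos_convex_span_of_mem_convexHull hx
    have hcard : Fintype.card ι ≤ Fintype.card κ := by
      rw [Fintype.card_fin]
      exact hind.card_le_finrank_succ.trans
        (Nat.succ_le_succ (Submodule.finrank_le _))
    obtain ⟨e⟩ := Function.Embedding.nonempty_of_card_le hcard
    -- Unused indices are padded with weight zero and the point `x₀`.
    refine ⟨(Function.extend e w 0, Function.extend e z fun _ => x₀), ⟨⟨?_, ?_⟩, ?_⟩, ?_⟩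
    · intro i
      by_cases hi : i ∈ range e
      · obtain ⟨j, rfl⟩ := hi
        simp [e.injective.extend_apply, (hw j).le]
      · have : ¬ ∃ a, e a = i := hi
        simp [Function.extend_apply' _ _ _ this]
    · rw [← hw1]
      refine (Fintype.sum_of_injective e e.injective _ _ (fun i hi => ?_) fun i => ?_).symm
      · have : ¬ ∃ a, e a = i := hi
        simp [Function.extend_apply' _ _ _ this]
      · simp [e.injective.extend_apply]
    · intro i _
      by_cases hi : i ∈ range e
      · obtain ⟨j, rfl⟩ := hi
        simpa [e.injective.extend_apply] using hz ⟨j, rfl⟩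
      · have : ¬ ∃ a, e a = i := hi
        simpa [Function.extend_apply' _ _ _ this] using hx₀
    · rw [← hwx]
      refine (Fintype.sum_of_injective e e.injective _ _ (fun i hi => ?_) fun i => ?_).symm
      · have : ¬ ∃ a, e a = i := hi
        simp [Function.extend_apply' _ _ _ this]
      · simp [e.injective.extend_apply]
  · rintro _ ⟨⟨w, z⟩, ⟨⟨hw, hw1⟩, hz⟩, rfl⟩
    exact (convex_convexHull ℝ s).sum_mem (fun i _ => hw i) hw1
      fun i _ => subset_convexHull ℝ s (hz i (mem_univ i))

namespace QuantumFolded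

/-! ### Continuity of a distance inducing the topology -/

section Distance

variable {E : Type*} {d : E → E → ℝ}

theorem IsDistance.self_eq_zero (hd : IsDistance d) (x : E) : d x x = 0 :=
  (hd.eq_zero_iff x x).2 rfl

theorem IsDistance.nonneg (hd : IsDistance d) (x y : E) : 0 ≤ d x y := by
  have h := hd.triangle x y x
  rw [hd.self_eq_zero, hd.symm y x] at h
  linarith

theorem IsDistance.eventually_lt [TopologicalSpace E] (hd : IsDistance d)
    (hd_top : InducesTopology d) (x : E) {ε : ℝ} (hε : 0 < ε) : ∀ᶠ y in nhds x, d x y < ε := by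
  have hopen : IsOpen {y | d x y < ε} := by
    refine (hd_top _).2 fun y hy => ⟨ε - d x y, sub_pos.2 hy, fun z hz => ?_⟩
    have := hd.triangle x y z
    change d x z < ε
    linarith
  exact hopen.mem_nhds (by simpa [hd.self_eq_zero] using hε)

theorem IsDistance.continuous [TopologicalSpace E] (hd : IsDistance d)
    (hd_top : InducesTopology d) : Continuous fun z : E × E => d z.1 z.2 := by
  refine continuous_iff_continuousAt.2 fun ⟨x, y⟩ => Metric.tendsto_nhds.2 fun ε hε => ?_
  rw [nhds_prod_eq]
  filter_upwards [(hd.eventually_lt hd_top x (half_pos hε)).prod_mk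
    (hd.eventually_lt hd_top y (half_pos hε))] with ⟨a, b⟩ ⟨ha, hb⟩
  simp only at ha hb ⊢
  rw [Real.dist_eq, abs_lt]
  have h1 := hd.triangle x a y
  have h2 := hd.triangle a b y
  have h3 := hd.triangle a x b
  have h4 := hd.triangle x y b
  rw [hd.symm b y] at h2
  rw [hd.symm a x] at h3
  constructor <;> linarith

end Distance

variable {H : Type*} [NormedAddCommGroup H] [InnerProductSpace ℂ H]

/-! ### Pure states and density matrices -/

theorem trace_pureState [FiniteDimensional ℂ H] (P : PureState H) :
    LinearMap.trace ℂ H ((P : H →L[ℂ] H) : H →ₗ[ℂ] H) = 1 := by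
  obtain ⟨_, ψ, hψ, rfl⟩ := P
  rw [InnerProductSpace.trace_rankOne, inner_self_eq_norm_sq_to_K, hψ]
  simp

theorem isCompact_pureStates [FiniteDimensional ℂ H] : IsCompact (pureStates H) := by
  have : ProperSpace H := FiniteDimensional.proper ℂ H
  have hc : Continuous fun ψ : H => InnerProductSpace.rankOne ℂ ψ ψ :=
    (ContinuousLinearMap.smulRightL ℂ H H).continuous₂.comp
      ((innerSL ℂ).continuous.prodMk continuous_id)
  convert (isCompact_sphere (0 : H) 1).image hc
  ext P
  simp [pureStates, eq_comm]

instance [FiniteDimensional ℂ H] : CompactSpace (PureState H) :=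
  isCompact_iff_compactSpace.1 isCompact_pureStates

/-- Density matrices are convex combinations of pure states. -/
theorem mem_convexHull_pureStates [FiniteDimensional ℂ H] {ρ : H →L[ℂ] H}
    (hρ : ρ ∈ densityMatrices H) : ρ ∈ convexHull ℝ (pureStates H) := by
  classical
  have := FiniteDimensional.complete ℂ H
  obtain ⟨hpos, htr⟩ := hρ
  obtain ⟨m, u, hu⟩ := ContinuousLinearMap.isPositive_iff_eq_sum_rankOne.1 hpos
  have hsum : ∑ i, ‖u i‖ ^ 2 = 1 := by
    rw [hu, ContinuousLinearMap.toLinearMap_sum, map_sum] at htr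
    simp only [InnerProductSpace.trace_rankOne, inner_self_eq_norm_sq_to_K,
      Complex.coe_algebraMap] at htr
    exact_mod_cast htr
  -- Zero vectors are discarded, since the others are to be normalised; the weights are the `‖u i‖ ^
  -- 2`.
  let t := Finset.univ.filter fun i => u i ≠ 0
  have hone : ∑ i ∈ t, ‖u i‖ ^ 2 = 1 := by
    rw [← hsum]
    refine Finset.sum_subset (Finset.subset_univ _) fun i _ hi => ?_
    have : u i = 0 := by simpa [t] using hi
    simp [this]
  have hrep : ∑ i ∈ t, ‖u i‖ ^ 2 • InnerProductSpace.rankOne ℂ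
      ((‖u i‖⁻¹ : ℂ) • u i) ((‖u i‖⁻¹ : ℂ) • u i) = ρ := by
    rw [hu, ← Finset.sum_subset (Finset.subset_univ t)]
    · refine Finset.sum_congr rfl fun i hi => ?_
      have hne : (‖u i‖ : ℂ) ≠ 0 := by simpa [t] using hi
      ext x
      simp only [smul_apply, InnerProductSpace.rankOne_apply,
        inner_smul_left, map_inv₀, Complex.conj_ofReal, smul_smul]
      rw [← Complex.coe_smul, smul_smul]
      congr 1
      push_cast
      field_simp
    · intro i _ hi
      have : u i = 0 := by simpa [t] using hi
      simp [this]
  rw [← hrep]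
  refine (convex_convexHull ℝ _).sum_mem (fun _ _ => by positivity) hone fun i hi =>
    subset_convexHull ℝ _ ⟨_, ?_, rfl⟩
  have hne : ‖u i‖ ≠ 0 := by simpa [t] using hi
  rw [norm_smul]
  simp [hne]

/-! ### Transport plans as points of a convex hull -/

/-- A pair of pure states together with its transport cost. -/
def costGraph (d : PureState H → PureState H → ℝ) (p : ℝ) (z : PureState H × PureState H) :
    ((H →L[ℂ] H) × (H →L[ℂ] H)) × ℝ :=
  (((z.1 : H →L[ℂ] H), (z.2 : H →L[ℂ] H)), d z.1 z.2 ^ p)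

variable {d : PureState H → PureState H → ℝ} {p : ℝ} {ρ σ : H →L[ℂ] H}

theorem continuous_costGraph (hd : IsDistance d) (hd_top : InducesTopology d) (hp : 1 ≤ p) :
    Continuous (costGraph d p) :=
  (by fun_prop : Continuous fun z : PureState H × PureState H =>
    ((z.1 : H →L[ℂ] H), (z.2 : H →L[ℂ] H))).prodMk
    ((hd.continuous hd_top).rpow_const fun _ => Or.inr (by linarith))

/-- The cost of a transport plan, as a real number. -/
def BFPlan.cost (d : PureState H → PureState H → ℝ) (p : ℝ) (t : BFPlan ρ σ) : ℝ :=
  ∑ j, t.q j * d (t.source j) (t.target j) ^ p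

theorem BFPlan.cost_nonneg (hd : IsDistance d) (t : BFPlan ρ σ) : 0 ≤ t.cost d p :=
  Finset.sum_nonneg fun j _ => mul_nonneg (t.q_pos j).le (Real.rpow_nonneg (hd.nonneg _ _) _)

theorem BFPlan.sum_ofReal (hd : IsDistance d) (t : BFPlan ρ σ) :
    ∑ j, ENNReal.ofReal (t.q j * d (t.source j) (t.target j) ^ p) =
      ENNReal.ofReal (t.cost d p) :=
  (ENNReal.ofReal_sum_of_nonneg fun j _ =>
    mul_nonneg (t.q_pos j).le (Real.rpow_nonneg (hd.nonneg _ _) _)).symm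

/-- Comparing traces: `ρ` and every pure state have trace one. -/
theorem BFPlan.sum_q [FiniteDimensional ℂ H] (hρ : ρ ∈ densityMatrices H) (t : BFPlan ρ σ) :
    ∑ j, t.q j = 1 := by
  have h := hρ.2
  rw [← t.sum_source, ContinuousLinearMap.toLinearMap_sum, map_sum] at h
  have hj : ∀ j, LinearMap.trace ℂ H
      ((t.q j • (t.source j : H →L[ℂ] H) : H →L[ℂ] H) : H →ₗ[ℂ] H) = (t.q j : ℂ) := fun j => by
    rw [← Complex.coe_smul, ContinuousLinearMap.toLinearMap_smul, map_smul, trace_pureState]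
    simp
  simp only [hj] at h
  exact_mod_cast h

theorem BFPlan.mem_convexHull [FiniteDimensional ℂ H] (hρ : ρ ∈ densityMatrices H)
    (t : BFPlan ρ σ) : ((ρ, σ), t.cost d p) ∈ convexHull ℝ (range (costGraph d p)) := by
  have h : ∑ j, t.q j • costGraph d p (t.source j, t.target j) = ((ρ, σ), t.cost d p) := by
    refine Prod.ext (Prod.ext ?_ ?_) ?_
    · simpa [Prod.fst_sum, costGraph] using t.sum_source
    · simpa [Prod.fst_sum, Prod.snd_sum, costGraph] using t.sum_target
    · simp [Prod.snd_sum, costGraph, BFPlan.cost]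
  rw [← h]
  exact (convex_convexHull ℝ _).sum_mem (fun j _ => (t.q_pos j).le) (t.sum_q hρ)
    fun j _ => subset_convexHull ℝ _ ⟨_, rfl⟩

/-- Converse of `BFPlan.mem_convexHull`. The Carathéodory expansion has strictly positive weights,
as a plan requires. -/
theorem exists_plan_of_mem_convexHull {c : ℝ}
    (h : ((ρ, σ), c) ∈ convexHull ℝ (range (costGraph d p))) :
    ∃ t : BFPlan ρ σ, t.cost d p = c := by
  obtain ⟨ι, _, z, w, hz, -, hw, hw1, hwx⟩ := eq_pos_convex_span_of_mem_convexHull h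
  choose g hg using fun i => hz (mem_range_self i)
  let e := (Fintype.equivFin ι).symm
  have hsum : ∑ j, w (e j) • costGraph d p (g (e j)) = ((ρ, σ), c) := by
    rw [← hwx, ← e.sum_comp]
    exact Finset.sum_congr rfl fun j _ => by rw [hg]
  have hcard : 0 < Fintype.card ι := by
    rw [Fintype.card_pos_iff]
    by_contra hne
    rw [not_nonempty_iff] at hne
    simp at hw1
  refine ⟨⟨Fintype.card ι, hcard, fun j => w (e j), fun j => hw _, fun j => (g (e j)).1,
    fun j => (g (e j)).2, ?_, ?_⟩, ?_⟩
  · simpa [Prod.fst_sum, costGraph] using congrArg (fun x => x.1.1) hsum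
  · simpa [Prod.fst_sum, Prod.snd_sum, costGraph] using congrArg (fun x => x.1.2) hsum
  · simpa [Prod.snd_sum, costGraph, BFPlan.cost] using congrArg (fun x => x.2) hsum

/-- Optimal transport plans exist. -/
theorem exists_optimal_plan [FiniteDimensional ℂ H] (hd : IsDistance d)
    (hd_top : InducesTopology d) (hp : 1 ≤ p)
    (hρ : ρ ∈ densityMatrices H) (hσ : σ ∈ densityMatrices H) :
    ∃ t : BFPlan ρ σ, ∀ t' : BFPlan ρ σ, t.cost d p ≤ t'.cost d p := by
  let C := convexHull ℝ (range (costGraph d p))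
  have hC : IsCompact C :=
    (isCompact_range (continuous_costGraph hd hd_top hp)).convexHull_of_finiteDimensional
  let S := C ∩ Prod.fst ⁻¹' {(ρ, σ)}
  have hS : IsCompact S := hC.inter_right (isClosed_singleton.preimage continuous_fst)
  have hne : S.Nonempty := by
    -- The slice is nonempty because convex hulls commute with products and with the linear
    -- projection forgetting the cost.
    have hmem : (ρ, σ) ∈ convexHull ℝ (pureStates H ×ˢ pureStates H) :=
      mk_mem_convexHull_prod (mem_convexHull_pureStates hρ) (mem_convexHull_pureStates hσ)
    have himg : pureStates H ×ˢ pureStates H =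
        LinearMap.fst ℝ ((H →L[ℂ] H) × (H →L[ℂ] H)) ℝ '' range (costGraph d p) := by
      ext ⟨P, Q⟩
      constructor
      · rintro ⟨hP, hQ⟩
        exact ⟨_, ⟨(⟨P, hP⟩, ⟨Q, hQ⟩), rfl⟩, rfl⟩
      · rintro ⟨_, ⟨⟨P', Q'⟩, rfl⟩, h⟩
        rw [← h]
        exact ⟨P'.2, Q'.2⟩
    rw [himg, ← LinearMap.image_convexHull] at hmem
    obtain ⟨x, hx, hx'⟩ := hmem
    exact ⟨x, hx, hx'⟩
  obtain ⟨⟨y, c⟩, ⟨hyC, hy⟩, hmin⟩ := hS.exists_isMinOn hne continuous_snd.continuousOn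
  obtain rfl : y = (ρ, σ) := hy
  obtain ⟨t, rfl⟩ := exists_plan_of_mem_convexHull hyC
  exact ⟨t, fun t' => hmin ⟨t'.mem_convexHull hρ, rfl⟩⟩

theorem beattyFranca_eq_of_optimal (hd : IsDistance d) {t : BFPlan ρ σ}
    (ht : ∀ t' : BFPlan ρ σ, t.cost d p ≤ t'.cost d p) :
    beattyFranca d p ρ σ = ENNReal.ofReal (t.cost d p) ^ (1 / p) := by
  unfold beattyFranca
  simp only [BFPlan.sum_ofReal hd]
  congr 1
  exact le_antisymm (iInf_le _ t) (le_iInf fun t' => ENNReal.ofReal_le_ofReal (ht t'))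

/-! ### Plans versus couplings -/

/-- The discrete probability measure on pairs of pure states defined by a transport plan. -/
def BFPlan.measure (t : BFPlan ρ σ) : Measure (PureState H × PureState H) :=
  ∑ j, ENNReal.ofReal (t.q j) • Measure.dirac (t.source j, t.target j)

theorem BFPlan.isProbabilityMeasure [FiniteDimensional ℂ H] (hρ : ρ ∈ densityMatrices H)
    (t : BFPlan ρ σ) : IsProbabilityMeasure t.measure := by
  constructor
  simp only [BFPlan.measure, Measure.coe_finsetSum, Finset.sum_apply, Measure.smul_apply,
    measure_univ, smul_eq_mul, mul_one]
  rw [← ENNReal.ofReal_sum_of_nonneg fun j _ => (t.q_pos j).le, t.sum_q hρ, ENNReal.ofReal_one]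

theorem BFPlan.integral_measure [FiniteDimensional ℂ H]
    {V : Type*} [NormedAddCommGroup V] [NormedSpace ℝ V] [CompleteSpace V]
    (t : BFPlan ρ σ) {f : PureState H × PureState H → V} (hf : StronglyMeasurable f) :
    ∫ z, f z ∂t.measure = ∑ j, t.q j • f (t.source j, t.target j) := by
  rw [BFPlan.measure, integral_finsetSum_measure]
  · refine Finset.sum_congr rfl fun j _ => ?_
    rw [integral_smul_measure, integral_dirac' _ _ hf, ENNReal.toReal_ofReal (t.q_pos j).le]
  · intro j _
    exact (integrable_dirac' hf (by simp)).smul_measure ENNReal.ofReal_ne_top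

theorem BFPlan.lintegral_measure [FiniteDimensional ℂ H] (t : BFPlan ρ σ)
    {f : PureState H × PureState H → ℝ≥0∞} (hf : Measurable f) :
    ∫⁻ z, f z ∂t.measure = ∑ j, ENNReal.ofReal (t.q j) * f (t.source j, t.target j) := by
  rw [BFPlan.measure, lintegral_finsetSum_measure]
  refine Finset.sum_congr rfl fun j _ => ?_
  rw [lintegral_smul_measure, lintegral_dirac' _ hf, smul_eq_mul]

/-- The measure of the plan couples its own marginals, whose barycenters are `ρ` and `σ`. -/
theorem foldedKantorovich_le_cost [FiniteDimensional ℂ H] (hd : IsDistance d)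
    (hd_top : InducesTopology d) (hp : 1 ≤ p) (hρ : ρ ∈ densityMatrices H) (t : BFPlan ρ σ) :
    foldedKantorovich d p ρ σ ≤ ENNReal.ofReal (t.cost d p) ^ (1 / p) := by
  have := t.isProbabilityMeasure hρ
  let π : ProbabilityMeasure (PureState H × PureState H) := ⟨t.measure, this⟩
  let μ := π.map measurable_fst.aemeasurable
  let ν := π.map measurable_snd.aemeasurable
  have hμ : μ ∈ representing ρ := by
    change ∫ P : PureState H, (P : H →L[ℂ] H) ∂(t.measure.map Prod.fst) = ρ
    rw [integral_map measurable_fst.aemeasurable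
      continuous_subtype_val.stronglyMeasurable.aestronglyMeasurable,
      t.integral_measure (f := fun z => (z.1 : H →L[ℂ] H))
        (continuous_subtype_val.comp continuous_fst).stronglyMeasurable]
    exact t.sum_source
  have hν : ν ∈ representing σ := by
    change ∫ P : PureState H, (P : H →L[ℂ] H) ∂(t.measure.map Prod.snd) = σ
    rw [integral_map measurable_snd.aemeasurable
      continuous_subtype_val.stronglyMeasurable.aestronglyMeasurable,
      t.integral_measure (f := fun z => (z.2 : H →L[ℂ] H))
        (continuous_subtype_val.comp continuous_snd).stronglyMeasurable]
    exact t.sum_target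
  refine (iInf₂_le μ hμ).trans ((iInf₂_le ν hν).trans ?_)
  refine ENNReal.rpow_le_rpow ((iInf₂_le π ⟨rfl, rfl⟩).trans ?_) (by positivity)
  change ∫⁻ z, ENNReal.ofReal (d z.1 z.2 ^ p) ∂t.measure ≤ _
  rw [t.lintegral_measure (f := fun z => ENNReal.ofReal (d z.1 z.2 ^ p))
    (continuous_costGraph hd hd_top hp).snd.measurable.ennreal_ofReal, ← t.sum_ofReal hd]
  exact (Finset.sum_congr rfl fun j _ => (ENNReal.ofReal_mul (t.q_pos j).le).symm).le

/-- Every coupling has the cost of some finite transport plan. -/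
theorem exists_plan_of_coupling [FiniteDimensional ℂ H] (hd : IsDistance d)
    (hd_top : InducesTopology d) (hp : 1 ≤ p) {μ ν : ProbabilityMeasure (PureState H)}
    (hμ : μ ∈ representing ρ) (hν : ν ∈ representing σ)
    {π : ProbabilityMeasure (PureState H × PureState H)} (hπ : π ∈ couplings μ ν) :
    ∃ t : BFPlan ρ σ, ENNReal.ofReal (t.cost d p) =
      ∫⁻ z, ENNReal.ofReal (d z.1 z.2 ^ p) ∂(π : Measure (PureState H × PureState H)) := by
  have hcont := continuous_costGraph hd hd_top hp
  have hint : Integrable (costGraph d p) (π : Measure (PureState H × PureState H)) :=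
    hcont.integrable_of_hasCompactSupport (HasCompactSupport.of_compactSpace _)
  -- A mean of points of a convex set stays in it once the set is closed; compactness of the hull
  -- supplies this.
  have hmem : ∫ z, costGraph d p z ∂(π : Measure (PureState H × PureState H)) ∈
      convexHull ℝ (range (costGraph d p)) :=
    (convex_convexHull ℝ _).integral_mem
      (isCompact_range hcont).convexHull_of_finiteDimensional.isClosed
      (.of_forall fun z => subset_convexHull ℝ _ ⟨z, rfl⟩) hint
  have hsrc : ∫ z, (costGraph d p z).1.1 ∂(π : Measure (PureState H × PureState H)) = ρ := by
    rw [← show _ = ρ from hμ, ← hπ.1, integral_map measurable_fst.aemeasurable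
      continuous_subtype_val.stronglyMeasurable.aestronglyMeasurable]
    rfl
  have htgt : ∫ z, (costGraph d p z).1.2 ∂(π : Measure (PureState H × PureState H)) = σ := by
    rw [← show _ = σ from hν, ← hπ.2, integral_map measurable_snd.aemeasurable
      continuous_subtype_val.stronglyMeasurable.aestronglyMeasurable]
    rfl
  have heq : ∫ z, costGraph d p z ∂(π : Measure (PureState H × PureState H)) =
      ((ρ, σ), ∫ z, (costGraph d p z).2 ∂(π : Measure (PureState H × PureState H))) := by
    refine Prod.ext (Prod.ext ?_ ?_) ?_
    · rw [fst_integral hint, fst_integral hint.fst, hsrc]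
    · rw [fst_integral hint, snd_integral hint.fst, htgt]
    · rw [snd_integral hint]
  rw [heq] at hmem
  obtain ⟨t, ht⟩ := exists_plan_of_mem_convexHull hmem
  exact ⟨t, by
    rw [ht]
    exact ofReal_integral_eq_lintegral_ofReal hint.snd
      (.of_forall fun z => Real.rpow_nonneg (hd.nonneg _ _) _)⟩

/-! ### Equality, finiteness and separation -/

theorem foldedKantorovich_eq_beattyFranca [FiniteDimensional ℂ H] (hd : IsDistance d)
    (hd_top : InducesTopology d) (hp : 1 ≤ p)
    (hρ : ρ ∈ densityMatrices H) (hσ : σ ∈ densityMatrices H) :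
    foldedKantorovich d p ρ σ = beattyFranca d p ρ σ := by
  obtain ⟨t, ht⟩ := exists_optimal_plan hd hd_top hp hρ hσ
  rw [beattyFranca_eq_of_optimal hd ht]
  refine le_antisymm (foldedKantorovich_le_cost hd hd_top hp hρ t) ?_
  refine le_iInf₂ fun μ hμ => le_iInf₂ fun ν hν => ENNReal.rpow_le_rpow ?_ (by positivity)
  refine le_iInf₂ fun π hπ => ?_
  obtain ⟨t', ht'⟩ := exists_plan_of_coupling hd hd_top hp hμ hν hπ
  rw [← ht']
  exact ENNReal.ofReal_le_ofReal (ht t')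

theorem beattyFranca_lt_top [FiniteDimensional ℂ H] (hd : IsDistance d)
    (hd_top : InducesTopology d) (hp : 1 ≤ p)
    (hρ : ρ ∈ densityMatrices H) (hσ : σ ∈ densityMatrices H) :
    beattyFranca d p ρ σ < ⊤ := by
  obtain ⟨t, ht⟩ := exists_optimal_plan hd hd_top hp hρ hσ
  rw [beattyFranca_eq_of_optimal hd ht]
  exact ENNReal.rpow_lt_top_of_nonneg (by positivity) ENNReal.ofReal_ne_top

/-- All terms are nonnegative and all weights positive, so each source coincides with its target. -/
theorem BFPlan.eq_of_cost_eq_zero (hd : IsDistance d) (hp : 1 ≤ p) (t : BFPlan ρ σ)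
    (h : t.cost d p = 0) : ρ = σ := by
  have hterm := (Finset.sum_eq_zero_iff_of_nonneg fun j _ =>
    mul_nonneg (t.q_pos j).le (Real.rpow_nonneg (hd.nonneg _ _) _)).1 h
  refine t.sum_source.symm.trans (Eq.trans ?_ t.sum_target)
  refine Finset.sum_congr rfl fun j hj => ?_
  have h0 := (mul_eq_zero.1 (hterm j hj)).resolve_left (t.q_pos j).ne'
  rw [Real.rpow_eq_zero (hd.nonneg _ _) (by linarith), hd.eq_zero_iff] at h0
  rw [h0]

theorem separatesPointsOn_beattyFranca [FiniteDimensional ℂ H] (hd : IsDistance d)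
    (hd_top : InducesTopology d) (hp : 1 ≤ p) :
    SeparatesPointsOn (densityMatrices H) (beattyFranca d p) := by
  intro ρ hρ σ hσ h
  obtain ⟨t, ht⟩ := exists_optimal_plan hd hd_top hp hρ hσ
  rw [beattyFranca_eq_of_optimal hd ht,
    ENNReal.rpow_eq_zero_iff_of_pos (by positivity), ENNReal.ofReal_eq_zero] at h
  exact t.eq_of_cost_eq_zero hd hp (le_antisymm h (t.cost_nonneg hd))

end QuantumFolded

end

theorem mainTheorem7 {H : Type*} [NormedAddCommGroup H] [InnerProductSpace ℂ H]
    [FiniteDimensional ℂ H]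
    (d : QuantumFolded.PureState H → QuantumFolded.PureState H → ℝ)
    (hd : QuantumFolded.IsDistance d) (hd_top : QuantumFolded.InducesTopology d)
    (p : ℝ) (hp : 1 ≤ p) :
    (∀ ρ ∈ QuantumFolded.densityMatrices H, ∀ σ ∈ QuantumFolded.densityMatrices H,
      QuantumFolded.foldedKantorovich d p ρ σ = QuantumFolded.beattyFranca d p ρ σ ∧
      QuantumFolded.foldedKantorovich d p ρ σ < ⊤) ∧
    QuantumFolded.SeparatesPointsOn (QuantumFolded.densityMatrices H)
      (QuantumFolded.foldedKantorovich d p) ∧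
    QuantumFolded.SeparatesPointsOn (QuantumFolded.densityMatrices H)
      (QuantumFolded.beattyFranca d p) := by
  have heq := fun ρ hρ σ hσ =>
    QuantumFolded.foldedKantorovich_eq_beattyFranca (ρ := ρ) (σ := σ) hd hd_top hp hρ hσ
  have hsep := QuantumFolded.separatesPointsOn_beattyFranca hd hd_top hp
  refine ⟨fun ρ hρ σ hσ => ⟨heq ρ hρ σ hσ, ?_⟩, fun ρ hρ σ hσ h => ?_, hsep⟩
  · rw [heq ρ hρ σ hσ]
    exact QuantumFolded.beattyFranca_lt_top hd hd_top hp hρ hσ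
  · exact hsep ρ hρ σ hσ (heq ρ hρ σ hσ ▸ h)
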